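/- Let $r \ge 0$ be an integer and let $\psi\colon \mathbb{Z}^r \to \mathbb{Z}^r$ be an injective group homomorphism. Then the ascending HNN group $$K = \langle \mathbb{Z}^r, t \mid t b t^{-1} = \psi(b) \text{ for all } b \in \mathbb{Z}^r \rangle$$ has virtual cohomological dimension equal to $r+1$. That is, $K$ is finitely generated and virtually torsion free, and every torsion free subgroup $K' \le K$ of finite index has cohomological dimension $r+1$, where the cohomological dimension of a group $G$ is the projective dimension of the trivial module $\mathbb{Z}$ over the group ring $\mathbb{Z}[G]$. -/

import Mathlib

/-- The ascending HNN extension `⟨G, t | t g t⁻¹ = ψ g for all g ∈ G⟩` of an injective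
endomorphism `ψ` of a group `G`: the HNN extension with associated subgroups `G` and `ψ(G)` and
the isomorphism `G ≃ ψ(G)` given by `ψ`. -/
abbrev AscendingHNN {G : Type} [Group G] (ψ : G →* G) (hψ : Function.Injective ψ) : Type :=
  HNNExtension G ⊤ ψ.range (Subgroup.topEquiv.trans (MonoidHom.ofInjective hψ))

/-- The defining relation `t g t⁻¹ = ψ g` of the ascending HNN extension. -/
theorem AscendingHNN.t_mul_of_mul_t_inv {G : Type} [Group G] (ψ : G →* G)
    (hψ : Function.Injective ψ) (g : G) :
    (HNNExtension.t * HNNExtension.of g * HNNExtension.t⁻¹ : AscendingHNN ψ hψ) =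
      HNNExtension.of (ψ g) :=
  (HNNExtension.equiv_eq_conj (φ := Subgroup.topEquiv.trans (MonoidHom.ofInjective hψ))
    ⟨g, Subgroup.mem_top g⟩).symm

/-- A (possibly nonabelian) group is torsion free if `1` is its only element of finite order.
(For nonabelian groups this is weaker than `IsMulTorsionFree`, which asks for unique roots.) -/
def IsTorsionFreeGroup (G : Type) [Group G] : Prop :=
  ∀ g : G, IsOfFinOrder g → g = 1

/-- The cohomological dimension of a group: the projective dimension of the trivial module `ℤ` in
the category of `ℤ[G]`-modules (representations of `G` on abelian groups). -/
noncomputable def groupCohomologicalDimension (G : Type) [Group G] : WithBot ℕ∞ :=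
  CategoryTheory.projectiveDimension (Rep.trivial ℤ G ℤ)

/-- `G` is a finitely generated, virtually torsion free group of virtual cohomological dimension
`n`: it has a torsion free subgroup of finite index, and every such subgroup has cohomological
dimension `n`. -/
structure HasVirtualCohomologicalDimension (G : Type) [Group G] (n : ℕ) : Prop where
  fg : Group.FG G
  virtually_torsionFree : ∃ H : Subgroup G, H.FiniteIndex ∧ IsTorsionFreeGroup H
  cohomologicalDimension_eq : ∀ H : Subgroup G, H.FiniteIndex → IsTorsionFreeGroup H →
    groupCohomologicalDimension H = (n : WithBot ℕ∞)

/-! Upper bound: if `S'` is an ascending HNN extension of `S` inside `G`, then `0 ⟶ ℤ[G/S] ⟶ ℤ[G/S]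
⟶ ℤ[G/S'] ⟶ 0` is exact, so the projective dimension grows by at most one. The coordinate flag of
`ℤ^r`, followed by the whole group, is a chain of `r + 1` such steps starting at the trivial
subgroup. Restriction carries the bound to all subgroups.

Lower bound: suppose `ψ` is the identity mod a prime `p`. Then each stable element is detected by a
character to `ZMod p` vanishing on the previous subgroup. Such a character gives a self-extension of
the trivial module `ZMod p`, and by induction the product of these classes, pulled back along the
augmentation, generates a nonzero `Ext^i(ℤ[G/S], ZMod p)` (`IsExtGenerating.step`). At the top this
is a nonzero `Ext^(r+1)(ℤ, ZMod p)`.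

In general `ψ` is invertible mod a large `p`, so some `ψ^m` is the identity mod `p`. A finite index
subgroup contains a copy of the HNN extension of a power of `ψ^m` (`AscendingHNN.powHom`), and so
inherits its lower bound. -/

open CategoryTheory CategoryTheory.Abelian

/-! ### Projective dimension under restriction -/

/-- A short complex of representations that is injective on the left, surjective on the right and
exact in the middle on elements is short exact. -/
theorem Rep.shortExact_of_injective_of_surjective {k : Type} [CommRing k] {G : Type} [Group G]
    {A B C : Rep.{0} k G} (f : A ⟶ B) (g : B ⟶ C) (w : f ≫ g = 0)
    (hf : Function.Injective f.hom) (hg : Function.Surjective g.hom)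
    (hfg : ∀ b, g.hom b = 0 → ∃ a, f.hom a = b) :
    (ShortComplex.mk f g w).ShortExact where
  exact := by
    refine (ShortComplex.exact_map_iff_of_faithful _
      (forget₂ (Rep.{0} k G) (ModuleCat.{0} k))).1 ?_
    rw [ShortComplex.moduleCat_exact_iff]
    exact hfg
  mono_f := (Rep.mono_iff_injective f).2 hf
  epi_g := (Rep.epi_iff_surjective g).2 hg

/-- Along an isomorphism a coinduced function is determined by its value at `1`, so lifting that one
value suffices. -/
theorem Rep.coindFunctor_preservesEpimorphisms_of_mulEquiv {G H : Type} [Group G] [Group H]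
    (e : H ≃* G) : (Rep.coindFunctor.{0} ℤ e.toMonoidHom).PreservesEpimorphisms where
  preserves {X Y} f _ := (Rep.epi_iff_surjective _).2 fun y => by
    obtain ⟨a, ha⟩ := (Rep.epi_iff_surjective f).1 ‹_› (y.1 1)
    refine ⟨⟨fun g => X.ρ (e.symm g) a, fun h g => ?_⟩, Subtype.ext <| funext fun g => ?_⟩
    · simp
    · have h := y.2 (e.symm g) 1
      simp only [MulEquiv.toMonoidHom_eq_coe, MonoidHom.coe_coe, MulEquiv.apply_symm_apply,
        mul_one] at h
      simp only [coindFunctor_obj, coindFunctor_map, hom_ofHom,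
        Representation.coindMap_coe_apply_apply, hom_comm_apply, ha]
      exact h.symm

/-- Factor `φ` as an isomorphism onto its range and a subgroup inclusion. Along the isomorphism,
restriction is left adjoint to coinduction, which preserves epimorphisms. -/
theorem Rep.resFunctor_preservesProjectiveObjects {G H : Type} [Group G] [Group H]
    (φ : H →* G) (hφ : Function.Injective φ) :
    (Rep.resFunctor.{0} (k := ℤ) φ).PreservesProjectiveObjects where
  projective_obj {P} hP := by
    let e : H ≃* φ.range := MonoidHom.ofInjective hφ
    have := Rep.coindFunctor_preservesEpimorphisms_of_mulEquiv e
    have h1 : (Rep.resFunctor.{0} (k := ℤ) e.toMonoidHom).PreservesProjectiveObjects :=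
      Functor.preservesProjectiveObjects_of_adjunction_of_preservesEpimorphisms
        (Rep.resCoindAdjunction ℤ e.toMonoidHom)
    have h2 : Projective (Rep.res φ.range.subtype P) :=
      (Rep.resFunctor.{0} (k := ℤ) φ.range.subtype).projective_obj P
    exact (Rep.resFunctor.{0} (k := ℤ) e.toMonoidHom).projective_obj (Rep.res φ.range.subtype P)

/-- Restriction along an injective homomorphism does not increase projective dimension. -/
theorem Rep.hasProjectiveDimensionLT_res {G H : Type} [Group G] [Group H]
    (φ : H →* G) (hφ : Function.Injective φ) (n : ℕ) (M : Rep.{0} ℤ G)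
    (hM : HasProjectiveDimensionLT M n) : HasProjectiveDimensionLT (Rep.res φ M) n := by
  have := Rep.resFunctor_preservesProjectiveObjects φ hφ
  induction n generalizing M with
  | zero =>
    rw [hasProjectiveDimensionLT_zero_iff_isZero] at hM ⊢
    exact (Rep.isZero_res_iff φ M).2 hM
  | succ n ih =>
    -- Dimension shifting compares the bounds `n + 2` and `n + 1`, so the bound `1`, projectivity,
    -- is treated apart.
    obtain _ | n := n
    · rw [zero_add, ← projective_iff_hasProjectiveDimensionLT_one] at hM ⊢
      exact (Rep.resFunctor.{0} (k := ℤ) φ).projective_obj M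
    · obtain ⟨P⟩ := EnoughProjectives.presentation M
      have hS : (ShortComplex.mk (Limits.kernel.ι P.f) P.f
          (Limits.kernel.condition P.f)).ShortExact :=
        { exact := ShortComplex.exact_kernel P.f }
      have hR := (Rep.shortExact_res φ).2 hS
      have hP : Projective (Rep.res φ P.p) :=
        (Rep.resFunctor.{0} (k := ℤ) φ).projective_obj P.p
      exact (hR.hasProjectiveDimensionLT_X₃_iff n hP).2
        (ih _ ((hS.hasProjectiveDimensionLT_X₃_iff n P.projective).1 hM))

theorem groupCohomologicalDimension_le_of_injective {G H : Type} [Group G] [Group H]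
    (φ : H →* G) (hφ : Function.Injective φ) (n : ℕ) (h : groupCohomologicalDimension G ≤ n) :
    groupCohomologicalDimension H ≤ n := by
  rw [groupCohomologicalDimension, projectiveDimension_le_iff] at h ⊢
  exact Rep.hasProjectiveDimensionLT_res φ hφ _ _ h

-- Propagating a generator of Ext along a short exact sequence

universe w v u

/-- `ε : M ⟶ N` exhibits `Ext^i(M, N)` as a nonzero group, generated by the pullback along `ε` of a
class in `Ext^i(N, N)`. -/
structure IsExtGenerating {C : Type u} [Category.{v} C] [Abelian C] [HasExt.{w} C] {M N : C}
    (ε : M ⟶ N) (i : ℕ) (ω : Ext N N i) : Prop where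
  ne_zero : (Ext.mk₀ ε).comp ω (zero_add i) ≠ 0
  exists_eq_zsmul : ∀ x : Ext M N i, ∃ k : ℤ, x = k • (Ext.mk₀ ε).comp ω (zero_add i)

theorem CategoryTheory.Abelian.Ext.comp_zsmul {C : Type u} [Category.{v} C] [Abelian C]
    [HasExt.{w} C] {X Y Z : C} {a b c : ℕ} (h : a + b = c) (k : ℤ) (x : Ext X Y a) (y : Ext Y Z b) :
    x.comp (k • y) h = k • x.comp y h :=
  map_zsmul (Ext.bilinearComp X Y Z a b c h x) k y

section

variable {C : Type u} [Category.{v} C] [Abelian C] [HasExt.{w} C] {M₁ M₂ M₃ N : C}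
  {f : M₁ ⟶ M₂} {g : M₂ ⟶ M₃} {zero : f ≫ g = 0} (hS : (ShortComplex.mk f g zero).ShortExact)
  {i : ℕ} {ω : Ext N N i} {ε₁ : M₁ ⟶ N} {ε₂ : M₂ ⟶ N}

include hS

/-- Every class in `Ext^i(M₂, N)` factors through `ε₂`, which `f` kills. So `f` induces zero there
and the connecting map is injective. -/
theorem IsExtGenerating.extClass_comp_ne_zero (h₁ : IsExtGenerating ε₁ i ω)
    (h₂ : IsExtGenerating ε₂ i ω) (h0 : f ≫ ε₂ = 0) :
    hS.extClass.comp ((Ext.mk₀ ε₁).comp ω (zero_add i)) (add_comm 1 i) ≠ 0 := by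
  intro h
  obtain ⟨y, hy⟩ := Ext.contravariant_sequence_exact₁ hS _ _ (add_comm 1 i) h
  obtain ⟨k, rfl⟩ := h₂.exists_eq_zsmul y
  apply h₁.ne_zero
  rw [← hy, Ext.comp_zsmul, Ext.mk₀_comp_mk₀_assoc]
  simp [h0]

/-- If `ε₁` extends to a morphism from `0 ⟶ M₁ ⟶ M₂ ⟶ M₃ ⟶ 0` to a self-extension of `N` with
last component `ε₃`, then `Ext^(i+1)(M₃, N)` is generated by a class pulled back along `ε₃`. -/
theorem IsExtGenerating.step (h₁ : IsExtGenerating ε₁ i ω)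
    (h₂ : IsExtGenerating ε₂ i ω) (h0 : f ≫ ε₂ = 0) [HasProjectiveDimensionLT M₂ (i + 1)]
    {E : C} {a : N ⟶ E} {b : E ⟶ N} {w : a ≫ b = 0}
    (hT : (ShortComplex.mk a b w).ShortExact) (φ : M₂ ⟶ E) (ε₃ : M₃ ⟶ N)
    (comm₁ : ε₁ ≫ a = f ≫ φ) (comm₂ : φ ≫ b = g ≫ ε₃) :
    IsExtGenerating ε₃ (i + 1) (hT.extClass.comp ω (add_comm 1 i)) := by
  let F : ShortComplex.mk f g zero ⟶ ShortComplex.mk a b w :=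
    { τ₁ := ε₁, τ₂ := φ, τ₃ := ε₃, comm₁₂ := comm₁, comm₂₃ := comm₂ }
  have key : (Ext.mk₀ ε₃).comp (hT.extClass.comp ω (add_comm 1 i)) (zero_add (i + 1)) =
      hS.extClass.comp ((Ext.mk₀ ε₁).comp ω (zero_add i)) (add_comm 1 i) := by
    rw [← Ext.comp_assoc (a₁₂ := 1) _ _ _ (by lia) (by lia) (by lia),
      ← Ext.comp_assoc (a₁₂ := 1) _ _ _ (by lia) (by lia) (by lia)]
    exact congrArg (fun z => Ext.comp z ω (add_comm 1 i))
      (ShortComplex.ShortExact.extClass_naturality hS hT F).symm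
  refine ⟨?_, fun x => ?_⟩
  · rw [key]
    exact h₁.extClass_comp_ne_zero hS h₂ h0
  -- The connecting map is onto because `Ext^(i+1)(M₂, N)` vanishes.
  · obtain ⟨y, rfl⟩ := Ext.contravariant_sequence_exact₃ hS _ x
      (Ext.eq_zero_of_hasProjectiveDimensionLT _ (i + 1) le_rfl) (add_comm 1 i)
    obtain ⟨k, rfl⟩ := h₁.exists_eq_zsmul y
    exact ⟨k, by rw [key, Ext.comp_zsmul]⟩

end

/-! ### Permutation modules -/

section Perm

variable (k : Type) [CommRing k] (G X : Type) [Group G] [MulAction G X]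

/-- The permutation representation `k[X]` of a `G`-set `X`. -/
noncomputable def permRepresentation : Representation k G (X →₀ k) where
  toFun g := Finsupp.lmapDomain k k (g • ·)
  map_one' := by ext; simp
  map_mul' a b := by ext; simp [mul_smul]

/-- The permutation representation `k[X]` of a `G`-set `X`, as an object of `Rep k G`. -/
noncomputable abbrev permRep : Rep.{0} k G := Rep.of (permRepresentation k G X)

variable {k G X}

@[simp]
theorem permRepresentation_single (g : G) (x : X) (c : k) :
    permRepresentation k G X g (Finsupp.single x c) = Finsupp.single (g • x) c := by
  simp [permRepresentation]

/-- The morphism `k[X] ⟶ A` extending an equivariant map `X → A`. -/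
noncomputable def permLift {A : Rep.{0} k G} (φ : X → A)
    (hφ : ∀ (g : G) x, φ (g • x) = A.ρ g (φ x)) :
    permRep k G X ⟶ A :=
  Rep.ofHom ⟨Finsupp.linearCombination k φ, fun g => by ext x; simp [hφ]⟩

@[simp]
theorem permLift_single {A : Rep.{0} k G} (φ : X → A)
    (hφ : ∀ (g : G) x, φ (g • x) = A.ρ g (φ x)) (x : X) (c : k) :
    (permLift φ hφ).hom (Finsupp.single x c) = c • φ x := by
  simp [permLift]

theorem permRep_hom_ext {A : Rep.{0} k G} {f g : permRep k G X ⟶ A}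
    (h : ∀ x, f.hom (Finsupp.single x 1) = g.hom (Finsupp.single x 1)) : f = g := by
  ext x
  exact h x

variable (k G X) in
/-- The augmentation `k[X] ⟶ A` with constant value `a`, into a trivial representation. -/
noncomputable def permAugmentation {A : Type} [AddCommGroup A] [Module k A] (a : A) :
    permRep k G X ⟶ Rep.trivial k G A :=
  permLift (fun _ => a) (fun _ _ => rfl)

theorem permAugmentation_single {A : Type} [AddCommGroup A] [Module k A] (a : A) (x : X) (c : k) :
    (permAugmentation k G X a).hom (Finsupp.single x c) = c • a :=
  permLift_single _ _ _ _

/-- The endomorphism `x ↦ f x - x` of `k[X]`. -/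
noncomputable def permDiff (f : X → X) (hf : ∀ (g : G) x, f (g • x) = g • f x) :
    permRep k G X ⟶ permRep k G X :=
  permLift (A := permRep k G X) (fun x => (Finsupp.single (f x) 1 - Finsupp.single x 1 : X →₀ k))
    (fun g x => by simp [hf])

/-- The morphism `k[X] ⟶ k[Y]` induced by an equivariant map. -/
noncomputable def permMap {Y : Type} [MulAction G Y] (q : X → Y)
    (hq : ∀ (g : G) x, q (g • x) = g • q x) : permRep k G X ⟶ permRep k G Y :=
  permLift (A := permRep k G Y) (fun x => (Finsupp.single (q x) 1 : Y →₀ k)) (fun g x => by simp [hq])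

theorem permDiff_single (f : X → X) (hf : ∀ (g : G) x, f (g • x) = g • f x) (x : X) :
    (permDiff (k := k) f hf).hom (Finsupp.single x 1) = Finsupp.single (f x) 1 - Finsupp.single x 1 :=
  (permLift_single _ _ _ _).trans (one_smul k _)

theorem permMap_single {Y : Type} [MulAction G Y] (q : X → Y)
    (hq : ∀ (g : G) x, q (g • x) = g • q x) (x : X) :
    (permMap (k := k) q hq).hom (Finsupp.single x 1) = Finsupp.single (q x) 1 :=
  (permLift_single _ _ _ _).trans (one_smul k _)

theorem permDiff_apply (f : X → X) (hf : ∀ (g : G) x, f (g • x) = g • f x) (a : X →₀ k) :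
    (permDiff (k := k) f hf).hom a = Finsupp.mapDomain f a - a := by
  have : (permDiff (k := k) f hf).hom.toLinearMap = Finsupp.lmapDomain k k f - LinearMap.id := by
    ext x : 2
    simpa using permDiff_single f hf x
  exact congr($this a)

theorem permMap_apply {Y : Type} [MulAction G Y] (q : X → Y)
    (hq : ∀ (g : G) x, q (g • x) = g • q x) (a : X →₀ k) :
    (permMap (k := k) q hq).hom a = Finsupp.mapDomain q a := by
  have : (permMap (k := k) q hq).hom.toLinearMap = Finsupp.lmapDomain k k q := by
    ext x : 2
    simpa using permMap_single q hq x
  exact congr($this a)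

/-- A self-map without periodic points fixes no nonzero finitely supported function. -/
theorem Finsupp.eq_zero_of_mapDomain_eq_self {k X : Type*} [AddCommMonoid k] (f : X → X)
    (hf : ∀ x n, 0 < n → f^[n] x ≠ x) (a : X →₀ k) (ha : Finsupp.mapDomain f a = a) : a = 0 := by
  classical
  by_contra h0
  obtain ⟨x, hx⟩ := Finsupp.support_nonempty_iff.2 h0
  -- By cardinality the inclusion is an equality, so `f` preserves the finite support and an orbit
  -- in it must repeat.
  have hsub : a.support ⊆ a.support.image f := by
    conv_lhs => rw [← ha]
    exact Finsupp.mapDomain_support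
  have himg : a.support = a.support.image f :=
    Finset.eq_of_subset_of_card_le hsub Finset.card_image_le
  have hmaps : ∀ n, f^[n] x ∈ a.support := by
    intro n
    induction n with
    | zero => exact hx
    | succ n ih =>
      rw [Function.iterate_succ_apply', himg]
      exact Finset.mem_image_of_mem f ih
  obtain ⟨m, n, hne, hmn⟩ := Finite.exists_ne_map_eq_of_infinite
    (fun n : ℕ => (⟨f^[n] x, hmaps n⟩ : a.support))
  wlog hlt : m < n generalizing m n
  · exact this n m hne.symm hmn.symm (by lia)
  refine hf (f^[m] x) (n - m) (by lia) ?_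
  rw [← Function.iterate_add_apply, Nat.sub_add_cancel hlt.le]
  exact (Subtype.ext_iff.1 hmn).symm

theorem permDiff_comp_permMap {Y : Type} [MulAction G Y] (f : X → X)
    (hf : ∀ (g : G) x, f (g • x) = g • f x) (q : X → Y)
    (hq : ∀ (g : G) x, q (g • x) = g • q x) (hqf : ∀ x, q (f x) = q x) :
    permDiff (k := k) f hf ≫ permMap (k := k) q hq = 0 := by
  apply permRep_hom_ext
  intro x
  change (permMap (k := k) q hq).hom ((permDiff (k := k) f hf).hom (Finsupp.single x 1)) = 0
  rw [permDiff_single, map_sub, permMap_single, permMap_single, hqf, sub_self]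

/-- If `f` has no periodic points and `Y` is the quotient of `X` by the relation generated by
`x ∼ f x`, then `0 ⟶ k[X] ⟶ k[X] ⟶ k[Y] ⟶ 0` is exact. -/
theorem permDiff_permMap_shortExact {Y : Type} [MulAction G Y] (f : X → X)
    (hf : ∀ (g : G) x, f (g • x) = g • f x) (q : X → Y)
    (hq : ∀ (g : G) x, q (g • x) = g • q x) (hqf : ∀ x, q (f x) = q x)
    (hper : ∀ x n, 0 < n → f^[n] x ≠ x) (hsurj : Function.Surjective q)
    (hfib : ∀ x y, q x = q y → ∃ m n, f^[m] x = f^[n] y) :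
    (ShortComplex.mk _ _ (permDiff_comp_permMap (k := k) f hf q hq hqf)).ShortExact := by
  apply Rep.shortExact_of_injective_of_surjective
  · rw [injective_iff_map_eq_zero]
    intro a ha
    rw [permDiff_apply, sub_eq_zero] at ha
    exact Finsupp.eq_zero_of_mapDomain_eq_self f hper a ha
  · intro b
    obtain ⟨a, ha⟩ := Finsupp.mapDomain_surjective hsurj b
    exact ⟨a, (permMap_apply q hq a).trans ha⟩
  · intro b hb
    rw [permMap_apply] at hb
    let R : Submodule k (X →₀ k) := LinearMap.range (permDiff (k := k) f hf).hom.toLinearMap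
    have hiter : ∀ x n, (Finsupp.single (f^[n] x) 1 - Finsupp.single x 1 : X →₀ k) ∈ R := by
      intro x n
      induction n with
      | zero => simp
      | succ n ih =>
        rw [Function.iterate_succ_apply', ← sub_add_sub_cancel _ (Finsupp.single (f^[n] x) 1)]
        exact R.add_mem ⟨_, permDiff_single f hf _⟩ ih
    obtain ⟨s, hs⟩ := hsurj.hasRightInverse
    -- Modulo `R` each `x` equals its iterates, and `x` shares an iterate with the chosen
    -- representative `s (q x)`. Hence `b` is determined modulo `R` by its image in `k[Y]`.
    have key : ∀ b : X →₀ k, Finsupp.mapDomain s (Finsupp.mapDomain q b) - b ∈ R := by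
      intro b
      induction b using Finsupp.induction_linear with
      | zero => simp
      | add a b ha hb =>
        rw [Finsupp.mapDomain_add, Finsupp.mapDomain_add, add_sub_add_comm]
        exact R.add_mem ha hb
      | single x c =>
        obtain ⟨m, n, hmn⟩ := hfib (s (q x)) x (hs (q x))
        have h := R.smul_mem c (R.sub_mem (hiter x n) (hiter (s (q x)) m))
        rw [hmn, sub_sub_sub_cancel_left] at h
        simpa [smul_sub] using h
    obtain ⟨c, hc⟩ := R.neg_mem (key b)
    refine ⟨c, hc.trans ?_⟩
    simp [hb]

end Perm

/-! ### Ascending chains of subgroups -/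

section Chain

variable {G : Type} [Group G]

/-- `S ≤ S'` is an ascending step with stable element `u`: the subgroup `S'` consists of the elements
`u ^ m * s * u ^ (-n)` with `s ∈ S`, where `u⁻¹ S u ⊆ S` and no positive power of `u` lies in `S`.
In other words, `S'` is an ascending HNN extension of `S` with stable letter `u⁻¹`. -/
structure IsAscendingStep (S S' : Subgroup G) (u : G) : Prop where
  le : S ≤ S'
  mem : u ∈ S'
  conj_mem : ∀ s ∈ S, u⁻¹ * s * u ∈ S
  pow_notMem : ∀ n : ℕ, 0 < n → u ^ n ∉ S
  exists_eq : ∀ w ∈ S', ∃ m n : ℕ, ∃ s ∈ S, w = u ^ m * s * (u ^ n)⁻¹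

namespace IsAscendingStep

variable {S S' : Subgroup G} {u : G} (h : IsAscendingStep S S' u)

/-- Right multiplication by `u` on `G ⧸ S`. -/
def rightMul : G ⧸ S → G ⧸ S :=
  Quotient.map' (· * u) fun a b hab => by
    rw [QuotientGroup.leftRel_apply] at hab ⊢
    simpa [mul_assoc] using h.conj_mem _ hab

theorem rightMul_mk (g : G) : h.rightMul (g : G ⧸ S) = ((g * u : G) : G ⧸ S) := rfl

theorem rightMul_smul (g : G) (x : G ⧸ S) : h.rightMul (g • x) = g • h.rightMul x := by
  induction x using QuotientGroup.induction_on with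
  | H a => exact congrArg _ (mul_assoc g a u)

theorem rightMul_iterate_mk (n : ℕ) (g : G) :
    h.rightMul^[n] (g : G ⧸ S) = ((g * u ^ n : G) : G ⧸ S) := by
  induction n with
  | zero => simp
  | succ n ih => rw [Function.iterate_succ_apply', ih, rightMul_mk, mul_assoc, pow_succ]

theorem rightMul_iterate_ne (x : G ⧸ S) (n : ℕ) (hn : 0 < n) : h.rightMul^[n] x ≠ x := by
  induction x using QuotientGroup.induction_on with
  | H g =>
    rw [rightMul_iterate_mk, ne_comm, Ne, QuotientGroup.eq, inv_mul_cancel_left]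
    exact h.pow_notMem n hn

theorem quotientMap_smul (g : G) (x : G ⧸ S) :
    Subgroup.quotientMapOfLE h.le (g • x) = g • Subgroup.quotientMapOfLE h.le x := by
  induction x using QuotientGroup.induction_on with
  | H a => rfl

theorem quotientMap_rightMul (x : G ⧸ S) :
    Subgroup.quotientMapOfLE h.le (h.rightMul x) = Subgroup.quotientMapOfLE h.le x := by
  induction x using QuotientGroup.induction_on with
  | H a =>
    rw [rightMul_mk, Subgroup.quotientMapOfLE_apply_mk, Subgroup.quotientMapOfLE_apply_mk, eq_comm,
      QuotientGroup.eq, inv_mul_cancel_left]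
    exact h.mem

theorem quotientMap_surjective : Function.Surjective (Subgroup.quotientMapOfLE h.le) := fun y => by
  induction y using QuotientGroup.induction_on with
  | H a => exact ⟨(a : G ⧸ S), rfl⟩

/-- Writing `a⁻¹ * b = u ^ m * s * (u ^ n)⁻¹` says that `a * u ^ m` and `b * u ^ n` lie in the same
coset of `S`. -/
theorem exists_iterate_eq (x y : G ⧸ S)
    (hxy : Subgroup.quotientMapOfLE h.le x = Subgroup.quotientMapOfLE h.le y) :
    ∃ m n, h.rightMul^[m] x = h.rightMul^[n] y := by
  induction x using QuotientGroup.induction_on with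
  | H a =>
  induction y using QuotientGroup.induction_on with
  | H b =>
    rw [Subgroup.quotientMapOfLE_apply_mk, Subgroup.quotientMapOfLE_apply_mk,
      QuotientGroup.eq] at hxy
    obtain ⟨m, n, s, hs, hw⟩ := h.exists_eq _ hxy
    refine ⟨m, n, ?_⟩
    rw [rightMul_iterate_mk, rightMul_iterate_mk, QuotientGroup.eq]
    convert hs using 1
    rw [inv_mul_eq_iff_eq_mul] at hw
    rw [hw]
    group

/-- For `S' = ⊤` this is the augmented chain complex of the Bass–Serre tree: the edge `gS` joins the
vertices `gS` and `guS`. -/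
theorem shortExact (k : Type) [CommRing k] :
    (ShortComplex.mk _ _ (permDiff_comp_permMap (k := k) h.rightMul h.rightMul_smul
      (Subgroup.quotientMapOfLE h.le) h.quotientMap_smul h.quotientMap_rightMul)).ShortExact :=
  permDiff_permMap_shortExact _ _ _ _ h.quotientMap_rightMul h.rightMul_iterate_ne
    h.quotientMap_surjective h.exists_iterate_eq

end IsAscendingStep

/-- The module is free on the trivial coset, so lifting the image of that coset defines the
factorization. -/
theorem permRep_quotient_bot_projective (k : Type) [CommRing k] :
    Projective (permRep k G (G ⧸ (⊥ : Subgroup G))) where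
  factors {E X} f e he := by
    obtain ⟨a, ha⟩ := (Rep.epi_iff_surjective e).1 he
      (f.hom (Finsupp.single ((1 : G) : G ⧸ (⊥ : Subgroup G)) 1))
    let o := (QuotientGroup.quotientBot (G := G))
    have ho : ∀ (g : G) x, o (g • x) = g * o x := fun g x => by
      induction x using QuotientGroup.induction_on with
      | H b => rfl
    refine ⟨permLift (A := E) (fun x => E.ρ (o x) a) (fun g x => by simp [ho]), ?_⟩
    apply permRep_hom_ext
    intro x
    induction x using QuotientGroup.induction_on with
    | H b =>
      change e.hom ((permLift (A := E) _ _).hom _) = _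
      rw [permLift_single, one_smul, Rep.hom_comm_apply, ha, ← Rep.hom_comm_apply]
      congr 1
      refine (permRepresentation_single _ _ _).trans ?_
      congr 1
      exact congrArg _ (mul_one b)

/-- `S` is reached from the trivial subgroup by `n` ascending steps. -/
inductive AscendingChain : Subgroup G → ℕ → Prop
  | bot : AscendingChain ⊥ 0
  | step {S S' : Subgroup G} {n : ℕ} {u : G} :
      AscendingChain S n → IsAscendingStep S S' u → AscendingChain S' (n + 1)

/-- `S` is reached from the trivial subgroup by `n` ascending steps, the stable element of each of
which is detected by a `ZMod p`-valued character vanishing on the smaller subgroup. -/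
inductive DetectedAscendingChain (p : ℕ) : Subgroup G → ℕ → Prop
  | bot : DetectedAscendingChain p ⊥ 0
  | step {S S' : Subgroup G} {n : ℕ} {u : G} (χ : G →* Multiplicative (ZMod p)) :
      DetectedAscendingChain p S n → IsAscendingStep S S' u → (∀ s ∈ S, χ s = 1) →
      χ u = Multiplicative.ofAdd 1 → DetectedAscendingChain p S' (n + 1)

theorem DetectedAscendingChain.ascendingChain {p : ℕ} {S : Subgroup G} {n : ℕ}
    (h : DetectedAscendingChain p S n) : AscendingChain S n := by
  induction h with
  | bot => exact .bot
  | step _ _ hu _ _ ih => exact .step ih hu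

theorem AscendingChain.hasProjectiveDimensionLT {S : Subgroup G} {n : ℕ} (h : AscendingChain S n)
    (k : Type) [CommRing k] : HasProjectiveDimensionLT (permRep k G (G ⧸ S)) (n + 1) := by
  induction h with
  | bot =>
    have := permRep_quotient_bot_projective (G := G) k
    infer_instance
  | step _ hu ih =>
    exact (hu.shortExact k).hasProjectiveDimensionLT_X₃ _ ih
      (hasProjectiveDimensionLT_of_ge _ _ _ (Nat.le_succ _))

/-! ### The self-extension of a trivial module given by a character -/

section Unipotent

variable (k : Type) {R : Type} [CommRing k] [CommRing R] [Algebra k R]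
  (χ : G →* Multiplicative R)

/-- The representation `(a, b) ↦ (a + χ g * b, b)` on `R × R` given by an additive character. -/
noncomputable def unipotentRepresentation : Representation k G (R × R) where
  toFun g := (LinearMap.fst k R R + LinearMap.mulLeft k (χ g).toAdd ∘ₗ LinearMap.snd k R R).prod
    (LinearMap.snd k R R)
  map_one' := by ext <;> simp
  map_mul' a b := by ext <;> simp [add_mul, add_comm]

theorem unipotentRepresentation_apply (g : G) (v : R × R) :
    unipotentRepresentation k χ g v = (v.1 + (χ g).toAdd * v.2, v.2) := rfl

/-- The inclusion of the trivial subrepresentation. -/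
noncomputable def unipotentInl :
    Rep.trivial k G R ⟶ Rep.of (unipotentRepresentation k χ) :=
  Rep.ofHom ⟨LinearMap.inl k R R, fun g => by ext <;> simp [unipotentRepresentation_apply]⟩

/-- The projection to the trivial quotient representation. -/
noncomputable def unipotentSnd :
    Rep.of (unipotentRepresentation k χ) ⟶ Rep.trivial k G R :=
  Rep.ofHom ⟨LinearMap.snd k R R, fun g => by ext <;> simp [unipotentRepresentation_apply]⟩

theorem unipotentInl_comp_unipotentSnd : unipotentInl k χ ≫ unipotentSnd k χ = 0 := by
  ext a
  rfl

theorem unipotent_shortExact :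
    (ShortComplex.mk _ _ (unipotentInl_comp_unipotentSnd k χ)).ShortExact := by
  apply Rep.shortExact_of_injective_of_surjective
  · exact LinearMap.inl_injective
  · exact LinearMap.snd_surjective
  · rintro ⟨a, b⟩ hb
    exact ⟨a, Prod.ext rfl (Eq.symm hb)⟩

variable {S : Subgroup G} (hχ : ∀ s ∈ S, χ s = 1)

/-- The morphism `ℤ[G ⧸ S] ⟶ R × R` with `g ↦ (χ g, 1)`. -/
noncomputable def unipotentLift : permRep k G (G ⧸ S) ⟶ Rep.of (unipotentRepresentation k χ) :=
  permLift (A := Rep.of (unipotentRepresentation k χ))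
    (fun x => (Quotient.liftOn' x (fun g => ((χ g).toAdd, (1 : R))) fun a b hab => by
      have h := hχ _ (QuotientGroup.leftRel_apply.1 hab)
      rw [map_mul, map_inv, inv_mul_eq_one] at h
      rw [h] : R × R))
    (fun g x => by
      induction x using QuotientGroup.induction_on with
      | H a =>
        change ((χ (g * a)).toAdd, (1 : R)) = ((χ a).toAdd + (χ g).toAdd * 1, (1 : R))
        rw [map_mul, toAdd_mul, mul_one, add_comm])

theorem unipotentLift_single (g : G) :
    (unipotentLift k χ hχ).hom (Finsupp.single (g : G ⧸ S) 1) = ((χ g).toAdd, (1 : R)) :=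
  (permLift_single _ _ _ _).trans (one_smul k _)

end Unipotent

/-! ### Nonvanishing Ext classes and bounds on the dimension -/

theorem isExtGenerating_permAugmentation_bot [HasExt.{0} (Rep.{0} ℤ G)] (p : ℕ) [Fact p.Prime] :
    IsExtGenerating (permAugmentation ℤ G (G ⧸ (⊥ : Subgroup G)) (1 : ZMod p)) 0
      (Ext.mk₀ (𝟙 _)) := by
  have hbij := fun M => Ext.mk₀_bijective M (Rep.trivial ℤ G (ZMod p))
  constructor
  · rw [Ext.comp_mk₀_id, Ne, Ext.mk₀_eq_zero_iff]
    intro h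
    have h1 := permAugmentation_single (k := ℤ) (G := G) (1 : ZMod p)
      ((1 : G) : G ⧸ (⊥ : Subgroup G)) 1
    rw [h, one_smul] at h1
    exact zero_ne_one h1
  · intro x
    obtain ⟨f, rfl⟩ := (hbij _).2 x
    obtain ⟨c, hc⟩ := ZMod.intCast_surjective
      (f.hom (Finsupp.single ((1 : G) : G ⧸ (⊥ : Subgroup G)) 1))
    refine ⟨c, ?_⟩
    rw [Ext.comp_mk₀_id]
    have : f = c • permAugmentation ℤ G (G ⧸ (⊥ : Subgroup G)) (1 : ZMod p) := by
      apply permRep_hom_ext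
      intro x
      induction x using QuotientGroup.induction_on with
      | H g =>
        have h1 : (Finsupp.single (g : G ⧸ (⊥ : Subgroup G)) (1 : ℤ)) =
            permRepresentation ℤ G _ g (Finsupp.single ((1 : G) : G ⧸ (⊥ : Subgroup G)) 1) := by
          rw [permRepresentation_single]
          exact congrArg (fun z : G => Finsupp.single (z : G ⧸ (⊥ : Subgroup G)) (1 : ℤ))
            (mul_one g).symm
        have h2 := (permAugmentation_single (k := ℤ) (G := G) (1 : ZMod p)
          (g : G ⧸ (⊥ : Subgroup G)) 1)
        rw [h1] at h2 ⊢
        refine (Rep.hom_comm_apply f g _).trans ?_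
        change f.hom _ = c • (permAugmentation ℤ G _ (1 : ZMod p)).hom _
        rw [h2, ← hc]
        simp
    rw [this]
    exact map_zsmul (Ext.addEquiv₀ (X := permRep ℤ G (G ⧸ (⊥ : Subgroup G)))).symm c _

/-- The augmentation is unchanged by right multiplication by `u`, hence kills `permDiff`. Vanishing
of `χ` on `S` makes the map to the unipotent module well defined, and `χ u = 1` makes the left
square commute. -/
theorem DetectedAscendingChain.exists_isExtGenerating [HasExt.{0} (Rep.{0} ℤ G)] {p : ℕ}
    [Fact p.Prime] {S : Subgroup G} {n : ℕ} (h : DetectedAscendingChain p S n) :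
    ∃ ω, IsExtGenerating (permAugmentation ℤ G (G ⧸ S) (1 : ZMod p)) n ω := by
  induction h with
  | bot => exact ⟨_, isExtGenerating_permAugmentation_bot p⟩
  | @step S S' n u χ hS hu hχ hχu ih =>
    obtain ⟨ω, hω⟩ := ih
    have := hS.ascendingChain.hasProjectiveDimensionLT ℤ
    refine ⟨_, hω.step (hu.shortExact ℤ) hω ?_ (unipotent_shortExact ℤ χ)
      (unipotentLift ℤ χ hχ) _ ?_ ?_⟩
    · apply permRep_hom_ext
      intro x
      change (permAugmentation ℤ G _ (1 : ZMod p)).hom ((permDiff _ _).hom _) = 0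
      rw [permDiff_single, map_sub, permAugmentation_single, permAugmentation_single, sub_self]
    · apply permRep_hom_ext
      intro x
      induction x using QuotientGroup.induction_on with
      | H g =>
        change (unipotentInl ℤ χ).hom ((permAugmentation ℤ G _ (1 : ZMod p)).hom _) =
          (unipotentLift ℤ χ hχ).hom ((permDiff _ _).hom _)
        rw [permDiff_single, map_sub, permAugmentation_single, hu.rightMul_mk,
          unipotentLift_single, unipotentLift_single, map_mul, hχu]
        change ((1 : ℤ) • (1 : ZMod p), (0 : ZMod p)) = _
        simp
    · apply permRep_hom_ext
      intro x
      induction x using QuotientGroup.induction_on with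
      | H g =>
        change (unipotentSnd ℤ χ).hom ((unipotentLift ℤ χ hχ).hom _) =
          (permAugmentation ℤ G _ (1 : ZMod p)).hom ((permMap _ _).hom _)
        rw [permMap_single, permAugmentation_single, unipotentLift_single, one_smul]
        rfl

theorem isIso_permAugmentation_quotient_top (k : Type) [CommRing k] :
    IsIso (permAugmentation k G (G ⧸ (⊤ : Subgroup G)) (1 : k)) := by
  have hsub : Subsingleton (G ⧸ (⊤ : Subgroup G)) := QuotientGroup.subsingleton_quotient_top
  have happ : ∀ a, (permAugmentation k G (G ⧸ (⊤ : Subgroup G)) (1 : k)).hom a =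
      a ((1 : G) : G ⧸ (⊤ : Subgroup G)) := fun a => by
    have ha : a = Finsupp.single ((1 : G) : G ⧸ (⊤ : Subgroup G)) (a ((1 : G) : G ⧸ ⊤)) :=
      Finsupp.eq_single_iff.2 ⟨fun x _ => Finset.mem_singleton.2 (Subsingleton.elim x _), rfl⟩
    conv_lhs => rw [ha, permAugmentation_single]
    simp
  have : Mono (permAugmentation k G (G ⧸ (⊤ : Subgroup G)) (1 : k)) := by
    rw [Rep.mono_iff_injective]
    intro a b hab
    rw [happ, happ] at hab
    ext x
    rwa [Subsingleton.elim x ((1 : G) : G ⧸ (⊤ : Subgroup G))]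
  have : Epi (permAugmentation k G (G ⧸ (⊤ : Subgroup G)) (1 : k)) := by
    rw [Rep.epi_iff_surjective]
    intro a
    exact ⟨Finsupp.single ((1 : G) : G ⧸ (⊤ : Subgroup G)) a, by simp [happ]⟩
  exact isIso_of_mono_of_epi _

theorem groupCohomologicalDimension_eq_permRep :
    groupCohomologicalDimension G = projectiveDimension (permRep ℤ G (G ⧸ (⊤ : Subgroup G))) :=
  have := isIso_permAugmentation_quotient_top (G := G) ℤ
  (projectiveDimension_eq_of_iso (asIso (permAugmentation ℤ G _ (1 : ℤ)))).symm

theorem AscendingChain.groupCohomologicalDimension_le {n : ℕ}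
    (h : AscendingChain (⊤ : Subgroup G) n) : groupCohomologicalDimension G ≤ n := by
  rw [groupCohomologicalDimension_eq_permRep, projectiveDimension_le_iff]
  exact h.hasProjectiveDimensionLT ℤ

theorem DetectedAscendingChain.le_groupCohomologicalDimension {p : ℕ} [Fact p.Prime] {n : ℕ}
    (h : DetectedAscendingChain p (⊤ : Subgroup G) n) : n ≤ groupCohomologicalDimension G := by
  rw [groupCohomologicalDimension_eq_permRep, projectiveDimension_ge_iff]
  intro hn
  have : HasExt.{0} (Rep.{0} ℤ G) := hasExt_of_enoughProjectives _
  obtain ⟨ω, hω⟩ := h.exists_isExtGenerating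
  exact hω.ne_zero (Ext.eq_zero_of_hasProjectiveDimensionLT _ n le_rfl)

end Chain

theorem IsAscendingStep.map {G G' : Type} [Group G] [Group G'] {S S' : Subgroup G} {u : G}
    (h : IsAscendingStep S S' u) (f : G →* G') (hf : Function.Injective f) :
    IsAscendingStep (S.map f) (S'.map f) (f u) where
  le := Subgroup.map_mono h.le
  mem := Subgroup.mem_map_of_mem f h.mem
  conj_mem := by
    rintro _ ⟨s, hs, rfl⟩
    exact ⟨_, h.conj_mem s hs, by simp⟩
  pow_notMem n hn := by
    rw [← map_pow, Subgroup.mem_map_iff_mem hf]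
    exact h.pow_notMem n hn
  exists_eq := by
    rintro _ ⟨w, hw, rfl⟩
    obtain ⟨m, n, s, hs, rfl⟩ := h.exists_eq w hw
    exact ⟨m, n, f s, Subgroup.mem_map_of_mem f hs, by simp⟩

/-! ### Normal form and homomorphisms of ascending HNN extensions -/

namespace AscendingHNN

section

variable {G : Type} [Group G] {ψ : G →* G} {hψ : Function.Injective ψ}

theorem t_mul_of (b : G) :
    (HNNExtension.t * HNNExtension.of b : AscendingHNN ψ hψ) =
      HNNExtension.of (ψ b) * HNNExtension.t := by
  rw [← t_mul_of_mul_t_inv, inv_mul_cancel_right]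

theorem t_pow_mul_of (n : ℕ) (b : G) :
    (HNNExtension.t ^ n * HNNExtension.of b : AscendingHNN ψ hψ) =
      HNNExtension.of (ψ^[n] b) * HNNExtension.t ^ n := by
  induction n with
  | zero => simp
  | succ n ih =>
    rw [pow_succ', mul_assoc, ih, ← mul_assoc, t_mul_of, mul_assoc, Function.iterate_succ_apply']

theorem of_mul_t_pow_inv (n : ℕ) (b : G) :
    (HNNExtension.of b * (HNNExtension.t ^ n)⁻¹ : AscendingHNN ψ hψ) =
      (HNNExtension.t ^ n)⁻¹ * HNNExtension.of (ψ^[n] b) := by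
  rw [mul_inv_eq_iff_eq_mul, mul_assoc, ← t_pow_mul_of, inv_mul_cancel_left]

/-- Every element of an ascending HNN extension is of the form `t ^ (-i) * b * t ^ j`. -/
theorem exists_eq_t_pow_inv_mul_of_mul_t_pow (g : AscendingHNN ψ hψ) :
    ∃ (i j : ℕ) (b : G),
      g = (HNNExtension.t ^ i)⁻¹ * HNNExtension.of b * HNNExtension.t ^ j := by
  induction g using HNNExtension.induction_on with
  | of b => exact ⟨0, 0, b, by simp⟩
  | t => exact ⟨0, 1, 1, by simp⟩
  | mul x y hx hy =>
    obtain ⟨i, j, b, rfl⟩ := hx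
    obtain ⟨k, l, c, rfl⟩ := hy
    refine ⟨k + i, j + l, ψ^[k] b * ψ^[j] c, ?_⟩
    calc _ = (HNNExtension.t ^ i)⁻¹ * HNNExtension.of b *
          (HNNExtension.t ^ j * (HNNExtension.t ^ k)⁻¹) * HNNExtension.of c *
          HNNExtension.t ^ l := by simp only [mul_assoc]
      _ = (HNNExtension.t ^ i)⁻¹ * (HNNExtension.of b * (HNNExtension.t ^ k)⁻¹) *
          (HNNExtension.t ^ j * HNNExtension.of c) * HNNExtension.t ^ l := by
        -- Once `t ^ j` and `(t ^ k)⁻¹` are swapped, the negative power moves left past `b` and the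
        -- positive one right past `c`, each applying iterates of `ψ`.
        rw [((Commute.refl (HNNExtension.t : AscendingHNN ψ hψ)).pow_pow j k).inv_right.eq]
        simp only [mul_assoc]
      _ = _ := by
        rw [of_mul_t_pow_inv, t_pow_mul_of, map_mul, pow_add, pow_add]
        group
  | inv x hx =>
    obtain ⟨i, j, b, rfl⟩ := hx
    exact ⟨j, i, b⁻¹, by simp [mul_assoc]⟩

/-- The homomorphism out of an ascending HNN extension given by its values on the base group and
on the stable letter. -/
noncomputable def lift {H : Type} [Group H] (f : G →* H) (x : H) (hx : ∀ b, x * f b = f (ψ b) * x) :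
    AscendingHNN ψ hψ →* H :=
  HNNExtension.lift f x fun a => hx a

@[simp]
theorem lift_of {H : Type} [Group H] (f : G →* H) (x : H) (hx : ∀ b, x * f b = f (ψ b) * x)
    (b : G) : lift (hψ := hψ) f x hx (HNNExtension.of b) = f b :=
  HNNExtension.lift_of _ _ _ _

@[simp]
theorem lift_t {H : Type} [Group H] (f : G →* H) (x : H) (hx : ∀ b, x * f b = f (ψ b) * x) :
    lift (hψ := hψ) f x hx HNNExtension.t = x :=
  HNNExtension.lift_t _ _ _

/-- The exponent of the stable letter. -/
noncomputable def height (ψ : G →* G) (hψ : Function.Injective ψ) :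
    AscendingHNN ψ hψ →* Multiplicative ℤ :=
  lift 1 (Multiplicative.ofAdd 1) fun _ => by simp

theorem height_t_pow_inv_mul_of_mul_t_pow (i j : ℕ) (b : G) :
    (height ψ hψ ((HNNExtension.t ^ i)⁻¹ * HNNExtension.of b * HNNExtension.t ^ j)).toAdd =
      (j : ℤ) - i := by
  simp [height, sub_eq_neg_add]

/-- A torsion element has height zero, so it is a conjugate of an element of the base group, which
embeds. -/
theorem isTorsionFreeGroup (hG : IsTorsionFreeGroup G) :
    IsTorsionFreeGroup (AscendingHNN ψ hψ) := by
  intro g hg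
  obtain ⟨i, j, b, rfl⟩ := exists_eq_t_pow_inv_mul_of_mul_t_pow g
  obtain ⟨n, hn, hpow⟩ := isOfFinOrder_iff_pow_eq_one.1 hg
  have hij : i = j := by
    have h := congrArg (fun x => (height ψ hψ x).toAdd) hpow
    simp only [map_pow, toAdd_pow, height_t_pow_inv_mul_of_mul_t_pow, map_one, toAdd_one,
      nsmul_eq_mul, mul_eq_zero] at h
    lia
  subst hij
  have hb : IsOfFinOrder b := by
    rw [isOfFinOrder_iff_pow_eq_one]
    refine ⟨n, hn, HNNExtension.of_injective (φ := Subgroup.topEquiv.trans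
      (MonoidHom.ofInjective hψ)) ?_⟩
    have h := conj_pow (a := (HNNExtension.t ^ i)⁻¹) (b := (HNNExtension.of b : AscendingHNN ψ hψ))
      (i := n)
    rw [inv_inv, hpow] at h
    rw [map_pow, map_one]
    calc _ = HNNExtension.t ^ i * ((HNNExtension.t ^ i)⁻¹ * HNNExtension.of b ^ n *
          HNNExtension.t ^ i) * (HNNExtension.t ^ i)⁻¹ := by group
      _ = 1 := by rw [← h, mul_one, mul_inv_cancel]
  simp [hG b hb]

theorem fg [Group.FG G] : Group.FG (AscendingHNN ψ hψ) := by
  obtain ⟨S, hS, hfin⟩ := Group.fg_iff.1 ‹Group.FG G›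
  refine Group.fg_iff.2 ⟨insert HNNExtension.t (HNNExtension.of '' S), ?_,
    (hfin.image _).insert _⟩
  rw [eq_top_iff]
  intro g _
  have hof : ∀ b, (HNNExtension.of b : AscendingHNN ψ hψ) ∈
      Subgroup.closure (insert HNNExtension.t (HNNExtension.of '' S)) := fun b => by
    apply Subgroup.closure_mono (Set.subset_insert _ _)
    rw [← MonoidHom.map_closure, hS]
    exact Subgroup.mem_map_of_mem _ (Subgroup.mem_top b)
  induction g using HNNExtension.induction_on with
  | of b => exact hof b
  | t => exact Subgroup.subset_closure (Set.mem_insert _ _)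
  | mul x y hx hy => exact mul_mem (hx trivial) (hy trivial)
  | inv x hx => exact inv_mem (hx trivial)

/-- The last step of the chain of subgroups of an ascending HNN extension: from the base group to
the whole group. -/
theorem isAscendingStep_range_of :
    IsAscendingStep (HNNExtension.of : G →* AscendingHNN ψ hψ).range ⊤ HNNExtension.t⁻¹ where
  le := le_top
  mem := Subgroup.mem_top _
  -- The stable element is `t⁻¹` because it is conjugation by `t` that maps the base group into
  -- itself.
  conj_mem := by
    rintro _ ⟨b, rfl⟩
    exact ⟨ψ b, by rw [inv_inv, t_mul_of_mul_t_inv]⟩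
  pow_notMem n hn := by
    rintro ⟨b, hb⟩
    have h := congrArg (fun x => (height ψ hψ x).toAdd) hb
    simp [height] at h
    lia
  exists_eq w _ := by
    obtain ⟨i, j, b, rfl⟩ := exists_eq_t_pow_inv_mul_of_mul_t_pow w
    exact ⟨i, j, _, ⟨b, rfl⟩, by simp⟩

/-- The homomorphism from the ascending HNN extension of `ψ ^ m` to that of `ψ` which raises
elements of a commutative base group to the power `k` and sends the stable letter to its `m`-th
power. -/
noncomputable def powHom {B : Type} [CommGroup B] {ψ θ : B →* B} (hψ : Function.Injective ψ)
    (hθ : Function.Injective θ) (k m : ℕ) (h : ∀ b, θ b = ψ^[m] b) :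
    AscendingHNN θ hθ →* AscendingHNN ψ hψ :=
  lift (HNNExtension.of.comp (powMonoidHom k)) (HNNExtension.t ^ m) fun b => by
    have hk : ψ^[m] (b ^ k) = ψ^[m] b ^ k := by rw [← h, ← h, map_pow]
    rw [MonoidHom.comp_apply, MonoidHom.comp_apply, powMonoidHom_apply, powMonoidHom_apply,
      t_pow_mul_of, h, hk]

end

section

variable {B : Type} [CommGroup B] {ψ θ : B →* B} (hψ : Function.Injective ψ)
  (hθ : Function.Injective θ) (k m : ℕ) (h : ∀ b, θ b = ψ^[m] b)

theorem powHom_apply (i j : ℕ) (b : B) :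
    powHom hψ hθ k m h ((HNNExtension.t ^ i)⁻¹ * HNNExtension.of b * HNNExtension.t ^ j) =
      (HNNExtension.t ^ (m * i))⁻¹ * HNNExtension.of (b ^ k) * HNNExtension.t ^ (m * j) := by
  simp [powHom, pow_mul]

/-- Height forces an element of the kernel to be a conjugate of some `b`; its image is then a
conjugate of `b ^ k` in the embedded base group. -/
theorem powHom_injective (hm : 0 < m) (hk : ∀ b : B, b ^ k = 1 → b = 1) :
    Function.Injective (powHom hψ hθ k m h) := by
  rw [injective_iff_map_eq_one]
  intro g hg
  obtain ⟨i, j, b, rfl⟩ := exists_eq_t_pow_inv_mul_of_mul_t_pow g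
  rw [powHom_apply] at hg
  have hij := congrArg (fun x => (height ψ hψ x).toAdd) hg
  simp only [height_t_pow_inv_mul_of_mul_t_pow, map_one, toAdd_one, sub_eq_zero,
    Nat.cast_inj] at hij
  obtain rfl := Nat.eq_of_mul_eq_mul_left hm hij
  rw [mul_assoc, inv_mul_eq_one, eq_comm, mul_eq_right] at hg
  have hb : b ^ k = 1 := HNNExtension.of_injective (φ := Subgroup.topEquiv.trans
    (MonoidHom.ofInjective hψ)) (hg.trans (map_one _).symm)
  simp [hk b hb]

end

end AscendingHNN

/-! ### The coordinate flag of `ℤ^r` -/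

section

variable {r : ℕ}

/-- The subgroup of `ℤ^r` of vectors supported on the first `i` coordinates. -/
def coordinateSubgroup (r i : ℕ) : Subgroup (Multiplicative (Fin r → ℤ)) where
  carrier := {v | ∀ j : Fin r, i ≤ j → v.toAdd j = 0}
  one_mem' _ _ := rfl
  mul_mem' ha hb j hj := by simp [ha j hj, hb j hj]
  inv_mem' ha j hj := by simp [ha j hj]

theorem coordinateSubgroup_zero : coordinateSubgroup r 0 = ⊥ := by
  rw [eq_bot_iff]
  intro v hv
  exact Multiplicative.toAdd.injective (funext fun j => hv j (Nat.zero_le _))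

theorem coordinateSubgroup_self : coordinateSubgroup r r = ⊤ := by
  rw [eq_top_iff]
  intro v _ j hj
  exact absurd j.2 (by lia)

theorem isAscendingStep_coordinateSubgroup (i : Fin r) :
    IsAscendingStep (coordinateSubgroup r i) (coordinateSubgroup r (i + 1))
      (Multiplicative.ofAdd (Pi.single i 1)) where
  le v hv j hj := hv j (by lia)
  mem j hj := by
    have : j ≠ i := fun h => by subst h; lia
    simp [this]
  conj_mem s hs := by rwa [mul_comm, mul_inv_cancel_left]
  pow_notMem n hn h := by
    have := h i le_rfl
    simp at this
    lia
  exists_eq w hw := by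
    -- The exponents are the positive and negative parts of the `i`-th coordinate, so the middle
    -- factor has `i`-th coordinate zero.
    refine ⟨(w.toAdd i).toNat, (-w.toAdd i).toNat, (Multiplicative.ofAdd (Pi.single i 1) ^
      (w.toAdd i).toNat)⁻¹ * w * Multiplicative.ofAdd (Pi.single i 1) ^ (-w.toAdd i).toNat,
      fun j hj => ?_, by group⟩
    obtain rfl | hne := eq_or_ne j i
    · simp
      lia
    · have : (j : ℕ) ≠ i := fun h => hne (Fin.ext h)
      simpa [hne] using hw j (by lia)

variable {ψ : Multiplicative (Fin r → ℤ) →* Multiplicative (Fin r → ℤ)}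
  (hψ : Function.Injective ψ)

theorem AscendingHNN.isAscendingStep_map_of (i : Fin r) :
    IsAscendingStep ((coordinateSubgroup r i).map (HNNExtension.of : _ →* AscendingHNN ψ hψ))
      ((coordinateSubgroup r (i + 1)).map HNNExtension.of)
      (HNNExtension.of (Multiplicative.ofAdd (Pi.single i 1))) :=
  (isAscendingStep_coordinateSubgroup i).map _ (HNNExtension.of_injective _)

theorem AscendingHNN.ascendingChain :
    AscendingChain (⊤ : Subgroup (AscendingHNN ψ hψ)) (r + 1) := by
  have h : ∀ i ≤ r, AscendingChain
      ((coordinateSubgroup r i).map (HNNExtension.of : _ →* AscendingHNN ψ hψ)) i := by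
    intro i
    induction i with
    | zero =>
      intro _
      rw [coordinateSubgroup_zero, Subgroup.map_bot]
      exact .bot
    | succ i ih => exact fun hi => (ih (by lia)).step (isAscendingStep_map_of hψ ⟨i, hi⟩)
  have hr := h r le_rfl
  rw [coordinateSubgroup_self, ← MonoidHom.range_eq_map] at hr
  exact hr.step isAscendingStep_range_of

/-- By `hp` each coordinate mod `p` is `ψ`-invariant, so it extends to a character of the HNN
extension that is trivial on `t`. -/
theorem AscendingHNN.detectedAscendingChain (p : ℕ)
    (hp : ∀ b i, (((ψ b).toAdd i : ℤ) : ZMod p) = (b.toAdd i : ℤ)) :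
    DetectedAscendingChain p (⊤ : Subgroup (AscendingHNN ψ hψ)) (r + 1) := by
  have h : ∀ i ≤ r, DetectedAscendingChain p
      ((coordinateSubgroup r i).map (HNNExtension.of : _ →* AscendingHNN ψ hψ)) i := by
    intro i
    induction i with
    | zero =>
      intro _
      rw [coordinateSubgroup_zero, Subgroup.map_bot]
      exact .bot
    | succ i ih =>
      intro hi
      let χ : AscendingHNN ψ hψ →* Multiplicative (ZMod p) :=
        lift (AddMonoidHom.toMultiplicative ((Int.castAddHom (ZMod p)).comp
          (Pi.evalAddMonoidHom _ (⟨i, hi⟩ : Fin r)))) 1 fun b => by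
            rw [one_mul, mul_one]
            exact congrArg Multiplicative.ofAdd (hp b ⟨i, hi⟩).symm
      have hχ : ∀ b, χ (HNNExtension.of b) =
          Multiplicative.ofAdd ((b.toAdd ⟨i, hi⟩ : ℤ) : ZMod p) := fun b => lift_of _ _ _ b
      refine (ih (by lia)).step χ (isAscendingStep_map_of hψ ⟨i, hi⟩) ?_ ?_
      · rintro _ ⟨b, hb, rfl⟩
        rw [hχ, hb ⟨i, hi⟩ le_rfl, Int.cast_zero, ofAdd_zero]
      · rw [hχ]
        simp
  have hr := h r le_rfl
  rw [coordinateSubgroup_self, ← MonoidHom.range_eq_map] at hr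
  -- The sign makes the character take the value `1` on the last stable element `t⁻¹`.
  refine hr.step (lift 1 (Multiplicative.ofAdd (-1)) fun _ => by simp) isAscendingStep_range_of
    ?_ ?_
  · rintro _ ⟨b, rfl⟩
    simp
  · rw [map_inv, lift_t, ← ofAdd_neg, neg_neg]

end

/-! ### Reduction mod `p` and finite index subgroups -/

theorem exists_prime_forall_iterate_modEq (r : ℕ)
    (ψ : Multiplicative (Fin r → ℤ) →* Multiplicative (Fin r → ℤ))
    (hψ : Function.Injective ψ) :
    ∃ p m : ℕ, p.Prime ∧ 0 < m ∧ ∀ b i, (((ψ^[m] b).toAdd i : ℤ) : ZMod p) = (b.toAdd i : ℤ) := by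
  let f : (Fin r → ℤ) →ₗ[ℤ] (Fin r → ℤ) := (AddMonoidHom.toMultiplicative.symm ψ).toIntLinearMap
  let A : Matrix (Fin r) (Fin r) ℤ := LinearMap.toMatrix' f
  have hA : ∀ b, (ψ b).toAdd = A.mulVec b.toAdd := fun b =>
    (LinearMap.toMatrix'_mulVec f b.toAdd).symm
  have hpow : ∀ m b, (ψ^[m] b).toAdd = (A ^ m).mulVec b.toAdd := by
    intro m b
    induction m with
    | zero => simp
    | succ m ih => rw [Function.iterate_succ_apply', hA, ih, pow_succ', Matrix.mulVec_mulVec]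
  have hdet : A.det ≠ 0 := by
    intro h0
    obtain ⟨v, hv, hv0⟩ := Matrix.exists_mulVec_eq_zero_iff.2 h0
    refine hv (Multiplicative.ofAdd.injective (hψ (Multiplicative.toAdd.injective ?_)))
    rw [hA]
    simpa using hv0
  -- A prime exceeding `|det A|` does not divide it, so `A` becomes invertible mod `p` and has
  -- finite order in a finite group.
  obtain ⟨p, hp, hprime⟩ := Nat.exists_infinite_primes (A.det.natAbs + 1)
  have : Fact p.Prime := ⟨hprime⟩
  let Ap := A.map (Int.castRingHom (ZMod p))
  have hunit : IsUnit Ap := by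
    rw [Matrix.isUnit_iff_isUnit_det, isUnit_iff_ne_zero]
    have : Ap.det = ((A.det : ℤ) : ZMod p) := (RingHom.map_det (Int.castRingHom (ZMod p)) A).symm
    rw [this, Ne, ZMod.intCast_zmod_eq_zero_iff_dvd]
    intro hdvd
    have := Nat.le_of_dvd (Int.natAbs_pos.2 hdet) (Int.natCast_dvd.1 hdvd)
    lia
  obtain ⟨U, hU⟩ := hunit
  obtain ⟨m, hm, hUm⟩ := isOfFinOrder_iff_pow_eq_one.1 (isOfFinOrder_of_finite U)
  refine ⟨p, m, hprime, hm, fun b i => ?_⟩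
  have hApm : (A ^ m).map (Int.castRingHom (ZMod p)) = 1 := by
    rw [Matrix.map_pow]
    change Ap ^ m = 1
    rw [← hU, ← Units.val_pow_eq_pow_val, hUm, Units.val_one]
  rw [hpow]
  refine (RingHom.map_mulVec (Int.castRingHom (ZMod p)) (A ^ m) b.toAdd i).trans ?_
  rw [hApm, Matrix.one_mulVec]
  rfl

theorem AscendingHNN.le_groupCohomologicalDimension {r : ℕ}
    (ψ : Multiplicative (Fin r → ℤ) →* Multiplicative (Fin r → ℤ)) (hψ : Function.Injective ψ)
    (K : Subgroup (AscendingHNN ψ hψ)) (hK : K.FiniteIndex) :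
    ((r + 1 : ℕ) : WithBot ℕ∞) ≤ groupCohomologicalDimension K := by
  obtain ⟨p, m, hp, hm, hpm⟩ := exists_prime_forall_iterate_modEq r ψ hψ
  have : Fact p.Prime := ⟨hp⟩
  have hn : 0 < K.normalCore.index := Nat.pos_of_ne_zero Subgroup.FiniteIndex.index_ne_zero
  have hmem : ∀ g, g ^ K.normalCore.index ∈ K := fun g =>
    K.normalCore_le (Subgroup.pow_index_mem _ g)
  generalize K.normalCore.index = n at hn hmem
  -- The factor `m` keeps `θ` the identity mod `p`. The factor `n` puts the image `t ^ (m * n)` of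
  -- the stable letter in `K`, as raising to the power `n` does for the base group.
  let θ : Multiplicative (Fin r → ℤ) →* Multiplicative (Fin r → ℤ) :=
    HPow.hPow (α := Monoid.End (Multiplicative (Fin r → ℤ))) ψ (m * n)
  have hθψ : ∀ b, θ b = ψ^[m * n] b := fun b =>
    congrFun (Monoid.End.coe_pow _ ψ (m * n)) b
  have hθ : Function.Injective θ := by
    rw [show ⇑θ = ψ^[m * n] from funext hθψ]
    exact hψ.iterate _
  have hθp : ∀ b i, (((θ b).toAdd i : ℤ) : ZMod p) = (b.toAdd i : ℤ) := by
    intro b i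
    rw [hθψ, Function.iterate_mul]
    clear hn hmem hθψ hθ
    induction n with
    | zero => rfl
    | succ n ih => rw [Function.iterate_succ_apply', hpm, ih]
  let φ := powHom hψ hθ n (m * n) hθψ
  have hφ : Function.Injective φ := powHom_injective hψ hθ n (m * n) hθψ (by positivity)
    fun b hb => by
      apply Multiplicative.toAdd.injective
      have h : n • b.toAdd = 0 := congrArg Multiplicative.toAdd hb
      exact (smul_eq_zero.1 h).resolve_left hn.ne'
  have hφK : ∀ g, φ g ∈ K := by
    intro g
    obtain ⟨i, j, b, rfl⟩ := exists_eq_t_pow_inv_mul_of_mul_t_pow g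
    have ht : ∀ l, (HNNExtension.t ^ (m * n * l) : AscendingHNN ψ hψ) ∈ K := fun l => by
      rw [mul_right_comm, pow_mul]
      exact hmem _
    rw [powHom_apply, map_pow]
    exact mul_mem (mul_mem (inv_mem (ht i)) (hmem _)) (ht j)
  -- A bound `r` for `K` would restrict along `φ` to the HNN extension of `θ`, whose dimension is at
  -- least `r + 1`.
  by_contra hlt
  rw [not_le, Nat.cast_add, Nat.cast_one] at hlt
  have hle := groupCohomologicalDimension_le_of_injective (φ.codRestrict K hφK)
    (fun a b hab => hφ (congrArg Subtype.val hab)) r (ENat.WithBot.lt_add_one_iff.1 hlt)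
  have h := (detectedAscendingChain hθ p hθp).le_groupCohomologicalDimension.trans hle
  exact absurd (Nat.cast_le.1 h) (by lia)

theorem mainTheorem8 (r : ℕ)
    (ψ : Multiplicative (Fin r → ℤ) →* Multiplicative (Fin r → ℤ))
    (hψ : Function.Injective ψ) :
    HasVirtualCohomologicalDimension (AscendingHNN ψ hψ) (r + 1) := by
  -- The HNN extension is itself torsion free, so `⊤` is a witness.
  refine ⟨AscendingHNN.fg, ⟨⊤, inferInstance, fun g hg => ?_⟩, fun K hK _ => ?_⟩
  · have htf : IsTorsionFreeGroup (Multiplicative (Fin r → ℤ)) := fun b hb => by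
      obtain ⟨n, hn, hbn⟩ := isOfFinOrder_iff_pow_eq_one.1 hb
      apply Multiplicative.toAdd.injective
      have h : n • b.toAdd = 0 := congrArg Multiplicative.toAdd hbn
      exact (smul_eq_zero.1 h).resolve_left hn.ne'
    exact Subtype.ext (AscendingHNN.isTorsionFreeGroup htf g.1 ((Subgroup.subtype _).isOfFinOrder hg))
  · exact le_antisymm
      (groupCohomologicalDimension_le_of_injective K.subtype K.subtype_injective _
        (AscendingHNN.ascendingChain hψ).groupCohomologicalDimension_le)
      (AscendingHNN.le_groupCohomologicalDimension ψ hψ K hK)
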